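/- A \emph{Catalan word} of length $n\ge 0$ is a word $w_1\cdots w_n$ of positive integers such that $w_1=1$ (if $n\ge1$) and $w_{i+1}\le w_i+1$ for all $1\le i\le n-1$; let $\mathcal C_n$ be the set of all of them. The bargraph of $w$ has as its $i$-th column the unit cells in rows $1,\dots,w_i$. For positive integers $r,s$, an $r\times s$ rectangle in $w$ is a block of $r$ consecutive rows and $s$ consecutive columns all of whose cells belong to the bargraph of $w$; let $\mathrm{rc}_{r\times s}(w)$ be the number of such blocks. Put \[P(x,t)=\sum_{n\ge 0}\Bigl(\sum_{w\in\mathcal C_n}t^{\mathrm{rc}_{1\times s}(w)}\Bigr)x^n,\qquad C(x)=\sum_{n\ge 0}C_nx^n,\] where $C_n=\frac1{n+1}\binom{2n}{n}$ are the Catalan numbers. \textbf{Theorem.} Let $r\ge 2$ and $s\ge 1$ be integers, and for $n\ge 0$ let $h_n=\sum_{w\in\mathcal C_n}\mathrm{rc}_{r\times s}(w)$ be the total number of $r\times s$ rectangles over all Catalan words of length $n$. Then, as formal power series, \[\sum_{n\ge 0}h_nx^n=\left(\frac{\partial P}{\partial t}(x,t)\Big|_{t=1}\right)\,(C(x)-1)^{r-1}.\]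 In particular, for every $n\ge 0$, \[h_n=\sum_{k=r}^{n+1-s}\frac{r-1}{k+r-2}\binom{2k-3}{k-r}\left(\sum_{i=0}^{s-2}\frac{s-1-i}{i+1}\binom{2i}{i}\binom{2(n+1-k)-2i}{n+1-k-i}-(2s-1)\binom{2(n+1-k)}{n+1-k}+4^{\,n+1-k}\right),\] where empty sums are $0$. -/

import Mathlib

/-- `w` is a Catalan word of length `n`: a word `w₁ ⋯ wₙ` of positive integers with `w₁ = 1`
and `wᵢ₊₁ ≤ wᵢ + 1`. The letters are indexed by `Fin n`, so `w₁` is the letter of index `0`.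
For `n = 0` the empty word is a Catalan word. -/
def IsCatalanWord {n : ℕ} (w : Fin n → ℕ) : Prop :=
  (∀ i, 1 ≤ w i) ∧ (∀ i : Fin n, i.val = 0 → w i = 1) ∧
    ∀ i j : Fin n, j.val = i.val + 1 → w j ≤ w i + 1

instance {n : ℕ} (w : Fin n → ℕ) : Decidable (IsCatalanWord w) := by
  unfold IsCatalanWord
  infer_instance

/-- The finite set of Catalan words of length `n`; by `mem_catalanWords` the restriction to
letters in `{1, …, n}` excludes none of them. -/
def catalanWords (n : ℕ) : Finset (Fin n → ℕ) :=
  (Fintype.piFinset fun _ : Fin n => Finset.Icc 1 n).filter fun w => IsCatalanWord w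

theorem IsCatalanWord.le_index {n : ℕ} {w : Fin n → ℕ} (h : IsCatalanWord w) :
    ∀ (k : ℕ) (hk : k < n), w ⟨k, hk⟩ ≤ k + 1 := by
  intro k
  induction k with
  | zero => intro hk; exact (h.2.1 ⟨0, hk⟩ rfl).le
  | succ k ih =>
    intro hk
    have h1 := h.2.2 ⟨k, by omega⟩ ⟨k + 1, hk⟩ rfl
    have h2 := ih (by omega)
    omega

theorem mem_catalanWords {n : ℕ} {w : Fin n → ℕ} : w ∈ catalanWords n ↔ IsCatalanWord w := by
  simp only [catalanWords, Finset.mem_filter, Fintype.mem_piFinset, Finset.mem_Icc,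
    and_iff_right_iff_imp]
  intro h i
  have h1 := h.le_index i.val i.isLt
  exact ⟨h.1 i, by have := i.isLt; simp only [Fin.eta] at h1; omega⟩

/-- The bargraph of a word, as its set of unit cells `(column, row)`: the `i`-th column
(columns and rows are counted from `1`) consists of the cells in the rows `1, …, wᵢ`. -/
def bargraph {n : ℕ} (w : Fin n → ℕ) : Finset (ℕ × ℕ) :=
  Finset.univ.biUnion fun i : Fin n => {i.val + 1} ×ˢ Finset.Icc 1 (w i)

/-- The cells of the `r × s` rectangle (`r` rows, `s` columns) whose lower left cell is `c`. -/
def rectangleCells (r s : ℕ) (c : ℕ × ℕ) : Finset (ℕ × ℕ) :=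
  Finset.Ico c.1 (c.1 + s) ×ˢ Finset.Ico c.2 (c.2 + r)

/-- The number of `r × s` rectangles (with `r, s ≥ 1`) contained in the bargraph of `w`. Each is
counted through its lower left cell, which belongs to the bargraph. -/
def rectangleCapacity (r s : ℕ) {n : ℕ} (w : Fin n → ℕ) : ℕ :=
  ((bargraph w).filter fun c => rectangleCells r s c ⊆ bargraph w).card

/-- The total number of `r × s` rectangles over all Catalan words of length `n`. -/
def totalRectangles (r s n : ℕ) : ℕ :=
  ∑ w ∈ catalanWords n, rectangleCapacity r s w

/-- The polynomial in `t` that records the distribution of the number of `1 × s` rectangles on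
the Catalan words of length `n`, i.e. the sum of `t ^ (number of 1 × s rectangles in w)`. -/
noncomputable def rowDistribution (s n : ℕ) : Polynomial ℚ :=
  ∑ w ∈ catalanWords n, Polynomial.X ^ rectangleCapacity 1 s w

/-- The generating function `P(x, t)`, as a power series in `x` over the polynomials in `t`. -/
noncomputable def rowGenFun (s : ℕ) : PowerSeries (Polynomial ℚ) :=
  PowerSeries.mk (rowDistribution s)

/-- The partial derivative with respect to `t`, at `t = 1`, of a power series in `x` whose
coefficients are polynomials in `t`. -/
noncomputable def partialTAtOne (F : PowerSeries (Polynomial ℚ)) : PowerSeries ℚ :=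
  PowerSeries.mk fun n => (Polynomial.derivative (PowerSeries.coeff n F)).eval 1

/-- The generating function of the Catalan numbers, with rational coefficients. -/
noncomputable def catalanGenFun : PowerSeries ℚ :=
  PowerSeries.map (Nat.castRingHom ℚ) PowerSeries.catalanSeries

/-! A nonempty Catalan word splits uniquely as `1 (u + 1) v` with `u`, `v` Catalan, the splitting of
a binary tree at its root. A rectangle of height at least 2 avoids columns of height 1, so it lies
over `u + 1` or over `v`; lowering `u + 1` turns height `r + 1` into `r`. For the series `H_r` of
totals this gives `H_{r+1} = x (H_r C + C H_{r+1})`, and `C = 1 + x C²` turns it into `H_{r+1} = (C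
- 1) H_r` (`rectangleGenFun_succ`). Since `H_1` is the `t`-derivative of `P` at 1, iteration proves
the product formula.

For the coefficients, each window of `s` columns holds exactly one more rectangle of height 1 than
of height 2. Hence `H_1 (2 - C) = W`, where `W` counts windows. With `B` the central binomial
series, `(1 + B)(2 - C) = 2`, so `2 H_1 = (1 + B) W` (`two_mul_rectangleGenFun_one`). The powers of
`C - 1 = x C²` have ballot-type coefficients, and convolution finishes. -/

open Finset

/-! ### Catalan words as binary trees -/

/-- The Catalan word, as a list, that a binary tree encodes: the left subtree is the part of the
word after the first letter and before the next letter equal to `1`, lowered by `1`. -/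
def treeWord : BinaryTree Unit → List ℕ
  | .nil => []
  | .node _ u v => 1 :: ((treeWord u).map (· + 1) ++ treeWord v)

/-- The list form of `IsCatalanWord`. -/
def IsCatalanList (l : List ℕ) : Prop :=
  (0 :: l).IsChain (fun a b => b ≤ a + 1) ∧ ∀ x ∈ l, 1 ≤ x

theorem isCatalanList_ofFn {n : ℕ} (w : Fin n → ℕ) :
    IsCatalanList (List.ofFn w) ↔ IsCatalanWord w := by
  unfold IsCatalanList IsCatalanWord
  rw [List.isChain_cons, List.isChain_iff_getElem]
  simp only [List.mem_ofFn', Set.mem_range, forall_exists_index, forall_apply_eq_imp_iff,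
    List.length_ofFn, List.getElem_ofFn]
  constructor
  · rintro ⟨⟨h0, h1⟩, h2⟩
    refine ⟨h2, ?_, ?_⟩
    · intro i hi
      have := h2 i
      have h3 := h0 (w i) (by
        cases n with
        | zero => exact i.elim0
        | succ n =>
          obtain rfl : i = 0 := Fin.ext hi
          simp [List.ofFn_succ])
      omega
    · rintro ⟨i, hi⟩ ⟨j, hj⟩ hij
      simp only at hij
      subst hij
      exact h1 i hj
  · rintro ⟨h1, h2, h3⟩
    refine ⟨⟨?_, fun i hi => h3 ⟨i, by omega⟩ ⟨i + 1, hi⟩ rfl⟩, h1⟩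
    intro y hy
    cases n with
    | zero => simp at hy
    | succ n =>
      simp only [List.ofFn_succ, List.head?_cons, Option.mem_def, Option.some.injEq] at hy
      rw [← hy, h2 0 rfl]

theorem length_treeWord (t : BinaryTree Unit) : (treeWord t).length = t.numNodes := by
  induction t with
  | nil => rfl
  | node _ u v hu hv => simp [treeWord, BinaryTree.numNodes, hu, hv]

theorem one_le_of_mem_treeWord (t : BinaryTree Unit) : ∀ x ∈ treeWord t, 1 ≤ x := by
  induction t with
  | nil => simp [treeWord]
  | node _ u v hu hv =>
    intro x hx
    simp only [treeWord, List.mem_cons, List.mem_append, List.mem_map] at hx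
    rcases hx with rfl | ⟨y, -, rfl⟩ | hx
    · exact le_rfl
    · omega
    · exact hv x hx

theorem head?_treeWord_eq_one {t : BinaryTree Unit} : ∀ x ∈ (treeWord t).head?, x = 1 := by
  cases t <;> simp [treeWord]

theorem isCatalanList_treeWord (t : BinaryTree Unit) : IsCatalanList (treeWord t) := by
  refine ⟨?_, one_le_of_mem_treeWord t⟩
  induction t with
  | nil => simp [treeWord]
  | node _ u v hu hv =>
    rw [treeWord, List.isChain_cons_cons, ← List.cons_append, List.isChain_append]
    refine ⟨by omega, ?_, (List.isChain_cons.1 hv).2, ?_⟩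
    · have : 1 :: (treeWord u).map (· + 1) = (0 :: treeWord u).map (· + 1) := by simp
      rw [this, List.isChain_map]
      exact hu.imp fun a b h => by omega
    · intro x _ y hy
      rw [head?_treeWord_eq_one y hy]
      omega

/-- Cut after the leading 1, just before the next letter 1: the chain condition forces what remains
to start with 1, so both pieces are again Catalan. -/
theorem exists_treeWord_eq (l : List ℕ) (hl : IsCatalanList l) : ∃ t, treeWord t = l := by
  induction hn : l.length using Nat.strong_induction_on generalizing l with
  | _ n ih =>
  obtain ⟨hc, hp⟩ := hl
  cases l with
  | nil => exact ⟨.nil, rfl⟩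
  | cons a l =>
    obtain ⟨ha, hc⟩ := List.isChain_cons_cons.1 hc
    have ha1 := hp a (by simp)
    obtain rfl : a = 1 := by omega
    set p : ℕ → Bool := fun x => decide (2 ≤ x) with hpdef
    have hsplit : l.takeWhile p ++ l.dropWhile p = l := List.takeWhile_append_dropWhile
    have hlen := congrArg List.length hsplit
    simp only [List.length_append, List.length_cons] at hlen hn
    have htake : ∀ x ∈ l.takeWhile p, 2 ≤ x := fun x hx => by
      simpa [hpdef] using List.mem_takeWhile_imp hx
    have hmap : ((l.takeWhile p).map (· - 1)).map (· + 1) = l.takeWhile p := by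
      rw [List.map_map]
      conv_rhs => rw [← List.map_id (l.takeWhile p)]
      refine List.map_congr_left fun x hx => ?_
      have := htake x hx
      simp only [Function.comp_apply, id]
      omega
    have hc' := hc
    rw [← hsplit, ← List.cons_append, List.isChain_append] at hc'
    obtain ⟨u, hu⟩ := ih _ (by simp; omega) ((l.takeWhile p).map (· - 1)) ⟨by
      have h1 : (0 :: (l.takeWhile p).map (· - 1)).map (· + 1) = 1 :: l.takeWhile p := by
        rw [List.map_cons, hmap]
      have h2 := hc'.1
      rw [← h1, List.isChain_map] at h2
      exact h2.imp fun a b h => by omega, by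
      intro x hx
      obtain ⟨y, hy, rfl⟩ := List.mem_map.1 hx
      have := htake y hy
      omega⟩ rfl
    obtain ⟨v, hv⟩ := ih _ (by omega) (l.dropWhile p) ⟨by
      rw [List.isChain_cons]
      refine ⟨fun y hy => ?_, hc'.2.1⟩
      have := List.head?_dropWhile_not p l
      rw [Option.mem_def.1 hy] at this
      simp [hpdef] at this
      omega, fun x hx => hp x (List.mem_cons_of_mem _
        ((List.dropWhile_sublist p).subset hx))⟩ rfl
    exact ⟨.node () u v, by rw [treeWord, hu, hv, hmap, hsplit]⟩

theorem treeWord_injective : Function.Injective treeWord := by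
  intro t
  induction t with
  | nil => intro t' h; cases t' <;> simp_all [treeWord]
  | node a u v hu hv =>
    intro t' h
    cases t' with
    | nil => simp [treeWord] at h
    | node a' u' v' =>
      simp only [treeWord, List.cons.injEq, true_and] at h
      have key : ∀ u v : BinaryTree Unit,
          ((treeWord u).map (· + 1) ++ treeWord v).takeWhile (fun x => decide (2 ≤ x)) =
            (treeWord u).map (· + 1) := by
        intro u v
        rw [List.takeWhile_append_of_pos]
        · cases v <;> simp [treeWord]
        · intro x hx
          obtain ⟨y, hy, rfl⟩ := List.mem_map.1 hx
          have := one_le_of_mem_treeWord u y hy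
          simpa using this
      have h1 : (treeWord u).map (· + 1) = (treeWord u').map (· + 1) := by
        rw [← key u v, ← key u' v', h]
      rw [h1] at h
      rw [hv (List.append_cancel_left h),
        hu (List.map_injective_iff.2 (add_left_injective 1) h1)]

theorem sum_catalanWords_ofFn {M : Type*} [AddCommMonoid M] (n : ℕ) (f : List ℕ → M) :
    ∑ w ∈ catalanWords n, f (List.ofFn w) =
      ∑ t ∈ BinaryTree.treesOfNumNodesEq n, f (treeWord t) := by
  rw [← sum_image (f := f) (g := List.ofFn) (fun _ _ _ _ h => List.ofFn_injective h),
    ← sum_image (f := f) (g := treeWord) (fun _ _ _ _ h => treeWord_injective h)]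
  congr 1
  ext l
  simp only [mem_image, mem_catalanWords, BinaryTree.mem_treesOfNumNodesEq]
  constructor
  · rintro ⟨w, hw, rfl⟩
    obtain ⟨t, ht⟩ := exists_treeWord_eq _ ((isCatalanList_ofFn w).2 hw)
    exact ⟨t, by rw [← length_treeWord, ht, List.length_ofFn], ht⟩
  · rintro ⟨t, rfl, rfl⟩
    rw [← length_treeWord]
    exact ⟨_, (isCatalanList_ofFn _).1 (by rw [List.ofFn_get]; exact isCatalanList_treeWord t),
      List.ofFn_get _⟩

/-- The sum over the binary trees with `n + 1` nodes, through the two subtrees of the root. -/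
theorem sum_treesOfNumNodesEq_succ {M : Type*} [AddCommMonoid M] (n : ℕ)
    (f : BinaryTree Unit → M) :
    ∑ t ∈ BinaryTree.treesOfNumNodesEq (n + 1), f t =
      ∑ ij ∈ antidiagonal n, ∑ u ∈ BinaryTree.treesOfNumNodesEq ij.1,
        ∑ v ∈ BinaryTree.treesOfNumNodesEq ij.2, f (.node () u v) := by
  rw [BinaryTree.treesOfNumNodesEq_succ, sum_biUnion]
  · refine sum_congr rfl fun ij _ => ?_
    rw [sum_map, sum_product]
    rfl
  · simp_rw [Set.PairwiseDisjoint, Set.Pairwise, disjoint_left]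
    aesop

/-! ### Rectangles counted by window minima -/

/-- The minimum of the first `s + 1` letters of a list, or `0` if there are fewer letters. -/
def prefixMin : ℕ → List ℕ → ℕ
  | _, [] => 0
  | 0, a :: _ => a
  | s + 1, a :: l => min a (prefixMin s l)

/-- The number of rectangles with `r` rows and `s + 1` columns in the bargraph of a list. -/
def listRectangles (r s : ℕ) : List ℕ → ℕ
  | [] => 0
  | a :: l => (prefixMin s (a :: l) + 1 - r) + listRectangles r s l

theorem prefixMin_cons_le (s a : ℕ) (l : List ℕ) : prefixMin s (a :: l) ≤ a := by
  cases s <;> simp [prefixMin]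

/-- Positivity of `m` makes the default letter 0 past the end fail the bound, matching the value 0
on short lists. -/
theorem le_prefixMin_iff {m : ℕ} (hm : 1 ≤ m) (s : ℕ) (l : List ℕ) :
    m ≤ prefixMin s l ↔ ∀ k < s + 1, m ≤ l.getD k 0 := by
  induction l generalizing s with
  | nil =>
    simp only [prefixMin, List.getD_nil]
    exact ⟨fun h => by omega, fun h => h 0 (by omega)⟩
  | cons a l ih =>
    cases s with
    | zero => simp [prefixMin]
    | succ s =>
      rw [prefixMin, le_min_iff, ih]
      constructor
      · rintro ⟨h1, h2⟩ k hk
        cases k with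
        | zero => exact h1
        | succ k => exact h2 k (by omega)
      · exact fun h => ⟨h 0 (by omega), fun k hk => h (k + 1) (by omega)⟩

/-- A window inside `u` is raised by 1. One that leaves `u` meets the letter 1 heading `v` or runs
off the end, so both sides are 0. -/
theorem prefixMin_map_succ_append (s : ℕ) (u v : List ℕ) (hv : ∀ x ∈ v.head?, x = 1) :
    prefixMin s (u.map (· + 1) ++ v) - 1 = prefixMin s u := by
  induction u generalizing s with
  | nil =>
    cases v with
    | nil => simp [prefixMin]
    | cons a v =>
      have h1 := prefixMin_cons_le s a v
      have h2 := hv a (by simp)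
      simp only [List.map_nil, List.nil_append, prefixMin]
      omega
  | cons a u ih =>
    cases s with
    | zero => simp [prefixMin]
    | succ s =>
      have := ih s
      simp only [List.map_cons, List.cons_append, prefixMin]
      omega

theorem listRectangles_map_succ_append {r : ℕ} (hr : 1 ≤ r) (s : ℕ) (u v : List ℕ)
    (hv : ∀ x ∈ v.head?, x = 1) :
    listRectangles (r + 1) s (u.map (· + 1) ++ v) =
      listRectangles r s u + listRectangles (r + 1) s v := by
  induction u with
  | nil => simp [listRectangles]
  | cons a u ih =>
    have := prefixMin_map_succ_append s (a :: u) v hv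
    simp only [List.map_cons, List.cons_append] at this
    simp only [List.map_cons, List.cons_append, listRectangles, ih]
    omega

/-- A full window of minimum `m ≥ 1` contributes `m` on the left and `m - 1` on the right; `l.length
- s` counts these windows. -/
theorem listRectangles_one_eq (s : ℕ) (l : List ℕ) (hl : ∀ x ∈ l, 1 ≤ x) :
    listRectangles 1 s l = (l.length - s) + listRectangles 2 s l := by
  have key : ∀ (l : List ℕ) (s : ℕ), (∀ x ∈ l, 1 ≤ x) → (1 ≤ prefixMin s l ↔ s < l.length) := by
    intro l
    induction l with
    | nil => intro s _; simp [prefixMin]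
    | cons a l ih =>
      intro s hl
      have ha := hl a (by simp)
      cases s with
      | zero => simp [prefixMin]; omega
      | succ s =>
        have := ih s fun x hx => hl x (List.mem_cons_of_mem _ hx)
        simp only [prefixMin, List.length_cons, le_min_iff]
        omega
  induction l with
  | nil => simp [listRectangles]
  | cons a l ih =>
    have h1 := key (a :: l) s hl
    have h2 := ih fun x hx => hl x (List.mem_cons_of_mem _ hx)
    simp only [listRectangles, List.length_cons] at h1 ⊢
    omega

theorem listRectangles_eq_zero {r s : ℕ} (hr : 1 ≤ r) {l : List ℕ} (hl : l.length ≤ s) :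
    listRectangles r s l = 0 := by
  have key : ∀ (l : List ℕ) (s : ℕ), l.length ≤ s → prefixMin s l = 0 := by
    intro l
    induction l with
    | nil => simp [prefixMin]
    | cons a l ih =>
      rintro (_ | s) hs
      · simp at hs
      · simp [prefixMin, ih s (by simpa using hs)]
  induction l with
  | nil => rfl
  | cons a l ih =>
    rw [List.length_cons] at hl
    rw [listRectangles, key _ _ hl, ih (by omega)]
    omega

theorem listRectangles_eq_sum (r s : ℕ) (l : List ℕ) :
    listRectangles r s l = ∑ i ∈ range l.length, (prefixMin s (l.drop i) + 1 - r) := by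
  induction l with
  | nil => simp [listRectangles]
  | cons a l ih =>
    rw [listRectangles, List.length_cons, sum_range_succ', ih, add_comm]
    simp

/-! ### Comparison with the bargraph -/

theorem mem_bargraph_iff {n : ℕ} (w : Fin n → ℕ) (c : ℕ × ℕ) :
    c ∈ bargraph w ↔ 1 ≤ c.1 ∧ 1 ≤ c.2 ∧ c.2 ≤ (List.ofFn w).getD (c.1 - 1) 0 := by
  obtain ⟨p, q⟩ := c
  simp only [bargraph, mem_biUnion, mem_univ, true_and, mem_product, mem_singleton, mem_Icc]
  constructor
  · rintro ⟨i, rfl, h1, h2⟩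
    refine ⟨by omega, h1, ?_⟩
    rw [Nat.add_sub_cancel, List.getD_eq_getElem _ _ (by simp)]
    simpa using h2
  · rintro ⟨h1, h2, h3⟩
    by_cases hp : p - 1 < n
    · rw [List.getD_eq_getElem _ _ (by simpa using hp)] at h3
      exact ⟨⟨p - 1, hp⟩, by simp; omega, h2, by simpa using h3⟩
    · rw [List.getD_eq_default _ _ (by simp; omega)] at h3
      omega

theorem rectangleCells_subset_bargraph_iff {r s n : ℕ} (hr : 1 ≤ r) (w : Fin n → ℕ) {c : ℕ × ℕ}
    (h1 : 1 ≤ c.1) (h2 : 1 ≤ c.2) :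
    rectangleCells r (s + 1) c ⊆ bargraph w ↔
      c.2 + r ≤ prefixMin s ((List.ofFn w).drop (c.1 - 1)) + 1 := by
  obtain ⟨p, q⟩ := c
  simp only at h1 h2 ⊢
  have : q + r ≤ prefixMin s ((List.ofFn w).drop (p - 1)) + 1 ↔
      q + r - 1 ≤ prefixMin s ((List.ofFn w).drop (p - 1)) := by omega
  rw [this, le_prefixMin_iff (by omega)]
  simp only [List.getD_eq_getElem?_getD, List.getElem?_drop]
  simp only [← List.getD_eq_getElem?_getD]
  constructor
  · intro h k hk
    have hc : (p + k, q + r - 1) ∈ rectangleCells r (s + 1) (p, q) := by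
      simp only [rectangleCells, mem_product, mem_Ico]
      omega
    have := ((mem_bargraph_iff w _).1 (h hc)).2.2
    simp only at this
    rwa [show p + k - 1 = p - 1 + k by omega] at this
  · rintro h ⟨p', q'⟩ hc
    simp only [rectangleCells, mem_product, mem_Ico] at hc
    rw [mem_bargraph_iff]
    have := h (p' - p) (by omega)
    rw [show p - 1 + (p' - p) = p' - 1 by omega] at this
    exact ⟨by simp only; omega, by simp only; omega, by simp only; omega⟩

theorem rectangleCapacity_eq_listRectangles {r : ℕ} (hr : 1 ≤ r) (s : ℕ) {n : ℕ} (w : Fin n → ℕ) :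
    rectangleCapacity r (s + 1) w = listRectangles r s (List.ofFn w) := by
  rw [listRectangles_eq_sum, List.length_ofFn, rectangleCapacity]
  have hset : (bargraph w).filter (fun c => rectangleCells r (s + 1) c ⊆ bargraph w) =
      ((range n).sigma fun i => Icc 1 (prefixMin s ((List.ofFn w).drop i) + 1 - r)).map
        ⟨fun x => (x.1 + 1, x.2), by rintro ⟨a, b⟩ ⟨c, d⟩ h; simp_all⟩ := by
    ext ⟨p, q⟩
    simp only [mem_filter, mem_map, mem_sigma, mem_range, mem_Icc, Sigma.exists]
    constructor
    · rintro ⟨hb, hs⟩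
      have hb' := (mem_bargraph_iff w _).1 hb
      simp only at hb'
      rw [rectangleCells_subset_bargraph_iff hr w hb'.1 hb'.2.1] at hs
      simp only at hs
      refine ⟨p - 1, q, ⟨?_, by omega, by omega⟩, Prod.ext (Nat.sub_add_cancel hb'.1) rfl⟩
      by_contra hp
      rw [List.getD_eq_default _ _ (by simp; omega)] at hb'
      omega
    · rintro ⟨i, b, ⟨hi, h1, h2⟩, h⟩
      obtain ⟨rfl, rfl⟩ := Prod.mk.inj h
      have hs : rectangleCells r (s + 1) (i + 1, b) ⊆ bargraph w := by
        rw [rectangleCells_subset_bargraph_iff hr w (by simp) h1]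
        simp only [Nat.add_sub_cancel]
        omega
      exact ⟨hs (by simp [rectangleCells]; omega), hs⟩
  rw [hset, card_map, card_sigma]
  simp

/-! ### Catalan and central binomial series -/

theorem catalanGenFun_eq : catalanGenFun = 1 + PowerSeries.X * catalanGenFun ^ 2 := by
  have h := congrArg (PowerSeries.map (Nat.castRingHom ℚ))
    PowerSeries.catalanSeries_sq_mul_X_add_one
  simp only [map_add, map_mul, map_pow, PowerSeries.map_X, map_one] at h
  rw [catalanGenFun]
  linear_combination -h

theorem coeff_catalanGenFun (n : ℕ) :
    PowerSeries.coeff n catalanGenFun = (catalan n : ℚ) := by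
  simp [catalanGenFun]

/-- The generating function of the central binomial coefficients. -/
noncomputable def centralBinomGenFun : PowerSeries ℚ :=
  PowerSeries.mk fun n => (Nat.centralBinom n : ℚ)

/-- `B` is the derivative of `x C`, because `(n + 1) C_n` is the central binomial coefficient;
differentiating the quadratic equation for `C` gives the rest. -/
theorem centralBinomGenFun_mul :
    centralBinomGenFun * (1 - 2 * PowerSeries.X * catalanGenFun) = 1 := by
  have h1 : centralBinomGenFun =
      catalanGenFun + PowerSeries.X * PowerSeries.derivative ℚ catalanGenFun := by
    ext n
    rw [centralBinomGenFun, PowerSeries.coeff_mk, ← succ_mul_catalan_eq_centralBinom, map_add,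
      coeff_catalanGenFun]
    cases n with
    | zero => simp
    | succ n =>
      rw [PowerSeries.coeff_succ_X_mul, PowerSeries.coeff_derivative, coeff_catalanGenFun]
      push_cast
      ring
  have h2 := congrArg (PowerSeries.derivative ℚ) catalanGenFun_eq
  rw [map_add, PowerSeries.derivative_one, Derivation.leibniz, PowerSeries.derivative_pow,
    PowerSeries.derivative_X] at h2
  simp only [smul_eq_mul, Nat.cast_ofNat, Nat.add_one_sub_one, pow_one, mul_one] at h2
  rw [h1]
  linear_combination PowerSeries.X * h2 + catalanGenFun_eq

theorem centralBinomGenFun_mul_two_sub :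
    centralBinomGenFun * (2 - catalanGenFun) = catalanGenFun := by
  linear_combination
    catalanGenFun * centralBinomGenFun_mul - 2 * centralBinomGenFun * catalanGenFun_eq

theorem coeff_centralBinomGenFun_sq (n : ℕ) :
    PowerSeries.coeff n (centralBinomGenFun ^ 2) = 4 ^ n := by
  -- `(1 - 2xC)² = 1 - 4x(C - xC²) = 1 - 4x`.
  have h : centralBinomGenFun ^ 2 * (1 - 4 * PowerSeries.X) = 1 := by
    linear_combination (centralBinomGenFun * (1 - 2 * PowerSeries.X * catalanGenFun) + 1) *
      centralBinomGenFun_mul + 4 * centralBinomGenFun ^ 2 * PowerSeries.X * catalanGenFun_eq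
  have h' : centralBinomGenFun ^ 2 =
      1 + PowerSeries.X * (PowerSeries.C 4 * centralBinomGenFun ^ 2) := by
    rw [show (PowerSeries.C (4 : ℚ)) = 4 from map_ofNat _ 4]
    linear_combination h
  induction n with
  | zero => rw [h']; simp
  | succ n ih =>
    rw [h', map_add, PowerSeries.coeff_succ_X_mul, PowerSeries.coeff_C_mul, ih,
      PowerSeries.coeff_one, if_neg n.succ_ne_zero, pow_succ]
    ring

/-- Double induction on `C^(q+1) = C^q + x C^(q+2)`, mirrored by Pascal's rule. The cleared
denominator also covers `a = q = 0`. -/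
theorem coeff_catalanGenFun_pow (a q : ℕ) :
    (2 * a + q : ℚ) * PowerSeries.coeff a (catalanGenFun ^ q) = q * Nat.choose (2 * a + q) a := by
  induction a generalizing q with
  | zero =>
    have h := coeff_catalanGenFun 0
    rw [PowerSeries.coeff_zero_eq_constantCoeff_apply] at h
    simp [h]
  | succ a ih =>
    induction q with
    | zero => simp [PowerSeries.coeff_one]
    | succ q ihq =>
      have hrec : catalanGenFun ^ (q + 1) =
          catalanGenFun ^ q + PowerSeries.X * catalanGenFun ^ (q + 2) := by
        linear_combination catalanGenFun ^ q * catalanGenFun_eq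
      have h := ih (q + 2)
      have hch := Nat.choose_succ_right_eq (2 * a + q + 2) a
      rw [show 2 * a + q + 2 - a = a + q + 2 by omega] at hch
      have hpas := Nat.choose_succ_succ' (2 * a + q + 2) a
      rw [hrec, map_add, PowerSeries.coeff_succ_X_mul,
        show 2 * (a + 1) + (q + 1) = 2 * a + q + 2 + 1 by ring, hpas]
      rw [show 2 * (a + 1) + q = 2 * a + q + 2 by ring] at ihq
      rw [show 2 * a + (q + 2) = 2 * a + q + 2 by ring] at h
      have hch' := congrArg (Nat.cast (R := ℚ)) hch
      push_cast at *
      generalize PowerSeries.coeff (a + 1) (catalanGenFun ^ q) = u at *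
      generalize PowerSeries.coeff a (catalanGenFun ^ (q + 2)) = v at *
      generalize ((2 * a + q + 2).choose (a + 1) : ℚ) = z at *
      generalize ((2 * a + q + 2).choose a : ℚ) = y at *
      have hN : (2 * a + q + 2 : ℚ) ≠ 0 := by positivity
      apply mul_left_cancel₀ hN
      linear_combination (2 * a + q + 3 : ℚ) * ihq + (2 * a + q + 3 : ℚ) * h - 2 * hch'

/-- Here `m = r - 2` and `a = k - r` in the final formula; the factor 2 is absorbed by the doubled
count of height 1. -/
theorem coeff_catalanGenFun_sub_one_pow (m a : ℕ) :
    PowerSeries.coeff (m + 1 + a) ((catalanGenFun - 1) ^ (m + 1)) =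
      2 * ((m + 1 : ℚ) / (a + 2 * m + 2) * Nat.choose (2 * m + 2 * a + 1) a) := by
  have h1 : (catalanGenFun - 1) ^ (m + 1) =
      PowerSeries.X ^ (m + 1) * catalanGenFun ^ (2 * m + 2) := by
    rw [show 2 * m + 2 = 2 * (m + 1) by ring, pow_mul, ← mul_pow]
    congr 1
    linear_combination catalanGenFun_eq
  have h2 := coeff_catalanGenFun_pow a (2 * m + 2)
  have h3 := congrArg (Nat.cast (R := ℚ)) (Nat.choose_mul_succ_eq (2 * m + 2 * a + 1) a)
  rw [show 2 * m + 2 * a + 1 + 1 - a = a + 2 * m + 2 by omega,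
    show 2 * m + 2 * a + 1 + 1 = 2 * a + (2 * m + 2) by ring] at h3
  rw [h1, add_comm (m + 1) a, PowerSeries.coeff_X_pow_mul]
  push_cast at h2 h3
  have hN : (2 * a + (2 * m + 2) : ℚ) ≠ 0 := by positivity
  have hM : (a + 2 * m + 2 : ℚ) ≠ 0 := by positivity
  have h4 : (m + 1 : ℚ) / (a + 2 * m + 2) * (2 * m + 2 * a + 1).choose a * (a + 2 * m + 2) =
      (m + 1) * (2 * m + 2 * a + 1).choose a := by
    field_simp
  apply mul_left_cancel₀ (mul_ne_zero hN hM)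
  linear_combination (a + 2 * m + 2 : ℚ) * h2 - (2 * m + 2 : ℚ) * h3 -
    2 * (2 * a + (2 * m + 2) : ℚ) * h4

theorem coeff_catalanGenFun_sub_one_pow_of_lt {m j : ℕ} (h : j < m) :
    PowerSeries.coeff j ((catalanGenFun - 1) ^ m) = 0 := by
  have h1 : (catalanGenFun - 1) ^ m = PowerSeries.X ^ m * catalanGenFun ^ (2 * m) := by
    rw [pow_mul, ← mul_pow]
    congr 1
    linear_combination catalanGenFun_eq
  rw [h1, PowerSeries.coeff_X_pow_mul', if_neg (by omega)]

/-! ### Recursions for the totals -/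

theorem totalRectangles_eq_sum_trees {r : ℕ} (hr : 1 ≤ r) (s n : ℕ) :
    totalRectangles r (s + 1) n =
      ∑ t ∈ BinaryTree.treesOfNumNodesEq n, listRectangles r s (treeWord t) := by
  rw [← sum_catalanWords_ofFn]
  exact sum_congr rfl fun w _ => rectangleCapacity_eq_listRectangles hr s w

theorem totalRectangles_eq_zero {r s n : ℕ} (hr : 1 ≤ r) (hn : n ≤ s) :
    totalRectangles r (s + 1) n = 0 := by
  rw [totalRectangles_eq_sum_trees hr]
  refine sum_eq_zero fun t ht => listRectangles_eq_zero hr ?_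
  rwa [length_treeWord, BinaryTree.mem_treesOfNumNodesEq.1 ht]

theorem totalRectangles_one_eq (s n : ℕ) :
    totalRectangles 1 (s + 1) n = (n - s) * catalan n + totalRectangles 2 (s + 1) n := by
  rw [totalRectangles_eq_sum_trees le_rfl, totalRectangles_eq_sum_trees one_le_two,
    ← BinaryTree.treesOfNumNodesEq_card_eq_catalan, mul_comm, ← smul_eq_mul, ← sum_const,
    ← sum_add_distrib]
  refine sum_congr rfl fun t ht => ?_
  rw [listRectangles_one_eq s _ (one_le_of_mem_treeWord t), length_treeWord,
    BinaryTree.mem_treesOfNumNodesEq.1 ht]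

theorem totalRectangles_succ_succ {r : ℕ} (hr : 1 ≤ r) (s n : ℕ) :
    totalRectangles (r + 1) (s + 1) (n + 1) =
      ∑ ij ∈ antidiagonal n, (totalRectangles r (s + 1) ij.1 * catalan ij.2 +
        catalan ij.1 * totalRectangles (r + 1) (s + 1) ij.2) := by
  rw [totalRectangles_eq_sum_trees (by omega), sum_treesOfNumNodesEq_succ]
  refine sum_congr rfl fun ij _ => ?_
  rw [totalRectangles_eq_sum_trees hr, totalRectangles_eq_sum_trees (by omega),
    ← BinaryTree.treesOfNumNodesEq_card_eq_catalan, ← BinaryTree.treesOfNumNodesEq_card_eq_catalan,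
    ← sum_const_nat (fun _ _ => rfl), sum_mul, ← sum_add_distrib]
  refine sum_congr rfl fun u _ => ?_
  rw [mul_comm, ← smul_eq_mul, ← sum_const, ← sum_add_distrib]
  refine sum_congr rfl fun v _ => ?_
  -- The window starting at the root letter has minimum at most 1, so its term vanishes by
  -- truncation as `r + 1 ≥ 2`.
  have h := prefixMin_cons_le s 1 ((treeWord u).map (· + 1) ++ treeWord v)
  rw [treeWord, listRectangles, listRectangles_map_succ_append hr s _ _ head?_treeWord_eq_one]
  omega

/-- The generating function of the total numbers of `r × s` rectangles. -/
noncomputable def rectangleGenFun (r s : ℕ) : PowerSeries ℚ :=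
  PowerSeries.mk fun n => (totalRectangles r s n : ℚ)

theorem rectangleGenFun_succ {r : ℕ} (hr : 1 ≤ r) (s : ℕ) :
    rectangleGenFun (r + 1) (s + 1) = rectangleGenFun r (s + 1) * (catalanGenFun - 1) := by
  have h : rectangleGenFun (r + 1) (s + 1) = PowerSeries.X *
      (rectangleGenFun r (s + 1) * catalanGenFun +
        catalanGenFun * rectangleGenFun (r + 1) (s + 1)) := by
    ext n
    cases n with
    | zero =>
      simp [rectangleGenFun, totalRectangles_eq_zero (show 1 ≤ r + 1 by omega) (Nat.zero_le s)]
    | succ n =>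
      rw [PowerSeries.coeff_succ_X_mul, map_add, PowerSeries.coeff_mul, PowerSeries.coeff_mul,
        ← sum_add_distrib, rectangleGenFun, PowerSeries.coeff_mk, totalRectangles_succ_succ hr,
        Nat.cast_sum]
      refine sum_congr rfl fun ij _ => ?_
      simp [rectangleGenFun, coeff_catalanGenFun]
  linear_combination catalanGenFun * h -
    (rectangleGenFun r (s + 1) + rectangleGenFun (r + 1) (s + 1)) * catalanGenFun_eq

theorem rectangleGenFun_eq_mul_pow (r s : ℕ) :
    rectangleGenFun (r + 1) (s + 1) = rectangleGenFun 1 (s + 1) * (catalanGenFun - 1) ^ r := by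
  induction r with
  | zero => simp
  | succ r ih => rw [rectangleGenFun_succ (by omega), ih, pow_succ, mul_assoc]

theorem partialTAtOne_rowGenFun (s : ℕ) : partialTAtOne (rowGenFun s) = rectangleGenFun 1 s := by
  ext n
  simp [partialTAtOne, rowGenFun, rectangleGenFun, rowDistribution, totalRectangles,
    Polynomial.eval_finsetSum,
    Polynomial.derivative_X_pow]

/-! ### Height 1 in closed form, and the theorem -/

/-- The polynomial that corrects the generating function of the signed window counts
`n - s` at the lengths `n < s`. -/
noncomputable def windowCorrection (s : ℕ) : PowerSeries ℚ :=
  PowerSeries.mk fun n => if n < s then ((s : ℚ) - n) * catalan n else 0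

theorem two_mul_rectangleGenFun_one (s : ℕ) :
    2 * rectangleGenFun 1 (s + 1) =
      centralBinomGenFun ^ 2 - PowerSeries.C (2 * (s : ℚ) + 1) * centralBinomGenFun +
        windowCorrection s * (1 + centralBinomGenFun) := by
  have h1 : rectangleGenFun 1 (s + 1) =
      centralBinomGenFun - PowerSeries.C ((s : ℚ) + 1) * catalanGenFun + windowCorrection s +
        rectangleGenFun 2 (s + 1) := by
    ext n
    rw [map_add, map_add, map_sub, PowerSeries.coeff_C_mul, coeff_catalanGenFun]
    simp only [rectangleGenFun, centralBinomGenFun, windowCorrection, PowerSeries.coeff_mk,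
      totalRectangles_one_eq, ← succ_mul_catalan_eq_centralBinom]
    split_ifs with h
    · rw [Nat.sub_eq_zero_of_le h.le]
      push_cast
      ring
    · push_cast [Nat.cast_sub (not_lt.1 h)]
      ring
  rw [rectangleGenFun_succ le_rfl] at h1
  have hB := centralBinomGenFun_mul_two_sub
  simp only [map_add, map_mul, map_one, map_ofNat] at h1 ⊢
  generalize PowerSeries.C (s : ℚ) = c at *
  -- Multiplying by `1 + B` inverts `2 - C` up to the factor 2, and `(1 + B) C = 2B`.
  linear_combination (1 + centralBinomGenFun) * h1 +
    (c + 1 - rectangleGenFun 1 (s + 1)) * hB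

/-- For `m ≥ s` the correction has no coefficient of its own at `m`; only its product with `B`
survives. -/
theorem two_mul_totalRectangles_one {s m : ℕ} (hm : s ≤ m) :
    2 * (totalRectangles 1 (s + 1) m : ℚ) =
      (∑ i ∈ range s, ((s : ℚ) - i) / (i + 1) * (Nat.choose (2 * i) i : ℚ) *
          (Nat.choose (2 * m - 2 * i) (m - i) : ℚ)) -
        (2 * (s : ℚ) + 1) * (Nat.choose (2 * m) m : ℚ) + 4 ^ m := by
  have h := congrArg (PowerSeries.coeff m) (two_mul_rectangleGenFun_one s)
  rw [← map_ofNat (PowerSeries.C (R := ℚ)) 2, map_add, map_sub, PowerSeries.coeff_C_mul,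
    PowerSeries.coeff_C_mul, coeff_centralBinomGenFun_sq, mul_add, mul_one, map_add,
    PowerSeries.coeff_mul, Nat.sum_antidiagonal_eq_sum_range_succ_mk] at h
  simp only [rectangleGenFun, centralBinomGenFun, windowCorrection, PowerSeries.coeff_mk,
    if_neg (not_lt.2 hm), Nat.centralBinom_eq_two_mul_choose m] at h
  rw [h, zero_add, ← sum_subset (range_subset_range.2 (show s ≤ m.succ by omega)) fun i _ hi => by
    rw [if_neg (by simpa using hi), zero_mul]]
  rw [sum_congr rfl fun i hi => ?_]
  · ring
  · rw [if_pos (mem_range.1 hi), Nat.centralBinom_eq_two_mul_choose, Nat.mul_sub,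
      ← Nat.centralBinom_eq_two_mul_choose i, ← succ_mul_catalan_eq_centralBinom]
    push_cast
    field_simp

theorem mainTheorem2 (r s : ℕ) (hr : 2 ≤ r) (hs : 1 ≤ s) :
    PowerSeries.mk (fun n => (totalRectangles r s n : ℚ)) =
        partialTAtOne (rowGenFun s) * (catalanGenFun - 1) ^ (r - 1) ∧
      ∀ n : ℕ, (totalRectangles r s n : ℚ) =
        ∑ k ∈ Finset.Icc r (n + 1 - s),
          ((r : ℚ) - 1) / ((k : ℚ) + (r : ℚ) - 2) * (Nat.choose (2 * k - 3) (k - r) : ℚ) *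
            ((∑ i ∈ Finset.range (s - 1),
                ((s : ℚ) - 1 - (i : ℚ)) / ((i : ℚ) + 1) * (Nat.choose (2 * i) i : ℚ) *
                  (Nat.choose (2 * (n + 1 - k) - 2 * i) (n + 1 - k - i) : ℚ))
              - (2 * (s : ℚ) - 1) * (Nat.choose (2 * (n + 1 - k)) (n + 1 - k) : ℚ)
              + 4 ^ (n + 1 - k)) := by
  obtain ⟨s, rfl⟩ := Nat.exists_eq_add_of_le' hs
  obtain ⟨m, rfl⟩ := Nat.exists_eq_add_of_le' hr
  have hH : rectangleGenFun (m + 2) (s + 1) =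
      rectangleGenFun 1 (s + 1) * (catalanGenFun - 1) ^ (m + 1) :=
    rectangleGenFun_eq_mul_pow (m + 1) s
  refine ⟨by rw [partialTAtOne_rowGenFun]; exact hH, fun n => ?_⟩
  have h := congrArg (PowerSeries.coeff n) hH
  rw [mul_comm, PowerSeries.coeff_mul, Nat.sum_antidiagonal_eq_sum_range_succ_mk] at h
  simp only [rectangleGenFun, PowerSeries.coeff_mk] at h
  -- Below `m + 1` the power of `C - 1` has no coefficient; from `n - s` on, the remaining words are
  -- too short. The sum is then shifted by `k = i + 1`.
  have hsub : Ico (m + 1) (n - s) ⊆ range n.succ := fun i hi => by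
    rw [mem_Ico] at hi
    rw [mem_range]
    omega
  rw [h, ← sum_subset hsub fun i hi hi' => ?_]
  · have hIcc : Icc (m + 2) (n + 1 - (s + 1)) = Ico (m + 1 + 1) (n - s + 1) := by
      ext k
      simp only [mem_Icc, mem_Ico]
      omega
    rw [hIcc, ← sum_Ico_add']
    refine sum_congr rfl fun i hi => ?_
    rw [mem_Ico] at hi
    obtain ⟨a, rfl⟩ := Nat.exists_eq_add_of_le hi.1
    have h2 := two_mul_totalRectangles_one (s := s) (m := n - (m + 1 + a)) (by omega)
    rw [coeff_catalanGenFun_sub_one_pow, mul_comm (2 : ℚ), mul_assoc, h2,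
      show n + 1 - (m + 1 + a + 1) = n - (m + 1 + a) by omega,
      show 2 * (m + 1 + a + 1) - 3 = 2 * m + 2 * a + 1 by omega,
      show m + 1 + a + 1 - (m + 2) = a by omega, Nat.add_sub_cancel]
    push_cast
    ring_nf
  · rw [mem_Ico, not_and_or] at hi'
    by_cases him : i < m + 1
    · rw [coeff_catalanGenFun_sub_one_pow_of_lt him, zero_mul]
    · rw [totalRectangles_eq_zero le_rfl (by omega), Nat.cast_zero, mul_zero]
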